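/- **Setting.** A left pseudocompact ring is a Hausdorff and complete topological ring in which zero has a fundamental system of open neighbourhoods consisting of left ideals $L$ such that $R/L$ is a left $R$-module of finite length. Let $R$ be a (left and right) noetherian left pseudocompact ring, $\sigma$ a topological automorphism of $R$, and $\delta : R \to R$ a continuous left $\sigma$-derivation, i.e. a continuous additive map with $\delta(ab) = \delta(a)b + \sigma(a)\delta(b)$ for all $a, b \in R$. Assume that $\delta$ is $\sigma$-nilpotent: for every $n \geq 1$ there is an $m \geq 1$ such that every composite of finitely many maps, each equal to $\delta$, $\sigma$ or $\sigma^{-1}$, with at least $m$ of them equal to $\delta$, maps $R$ into $\mathrm{Jac}(R)^n$. Let $S = R[[t;\sigma,\delta]]$ be the skew power series ring: its elements are the formal power series $\sum_{i \geq 0} a_i t^i$ with $a_i \in R$, with the multiplication $$\Big(\sum_{j} a_j t^j\Big)\Big(\sum_{l} b_l t^l\Big) = \sum_{m \geq 0} \Big(\sum_{n=0}^m \sum_{j \geq n} a_j M_{j-n,n}(\delta,\sigma)(b_{m-n})\Big) t^m ,$$ where $M_{k,l}(Y,Z)$ is the sum of all noncommutative monomials with $k$ factors $Y$ and $l$ factors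 $Z$ (so $ta = \sigma(a)t + \delta(a)$ for $a \in R$). Assume that $S$ is (left and right) noetherian. For a left $R$-module $M$ let ${}^\sigma M$ be the left $R$-module with the same underlying additive group on which $R$ acts through $\sigma^{-1}$. **Proposition 2.2.** Let $M$ be a left $S$-module which is finitely generated as an $R$-module. Then there are well-defined homomorphisms of left $S$-modules $\kappa$ and $\mu$ with $\kappa(x \otimes m) = xt \otimes m - x \otimes tm$ and $\mu(x \otimes m) = xm$ for all $x \in S$, $m \in M$, and $$0 \longrightarrow S \otimes_R {}^\sigma M \xrightarrow{\ \kappa\ } S \otimes_R M \xrightarrow{\ \mu\ } M \longrightarrow 0$$ is an exact sequence of finitely generated left $S$-modules. -/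

import Mathlib

open Filter Topology

/-- A left pseudocompact ring: a Hausdorff and complete topological ring in which zero has a
fundamental system of open neighbourhoods that are left ideals `L` with `R ⧸ L` of finite length
as a left `R`-module. (The uniformity is the one of the topological additive group `R`.) -/
class IsLeftPseudocompactRing (R : Type*) [Ring R] [UniformSpace R] : Prop
    extends IsUniformAddGroup R, IsTopologicalRing R, T2Space R, CompleteSpace R where
  exists_open_left_ideal : ∀ U ∈ 𝓝 (0 : R), ∃ L : Ideal R,
    IsOpen (L : Set R) ∧ (L : Set R) ⊆ U ∧ IsFiniteLength R (R ⧸ L)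

/-- `IsSkewMonomial σ δ k f`: the map `f` is the value `M(δ, σ, σ⁻¹)` of a noncommutative monomial
`M(Y, Z, Z')` in three variables with exactly `k` factors `Y`. -/
inductive IsSkewMonomial {R : Type*} [Ring R] (σ : R ≃+* R) (δ : R →+ R) : ℕ → (R → R) → Prop
  | one : IsSkewMonomial σ δ 0 (fun a => a)
  | delta {k : ℕ} {f : R → R} : IsSkewMonomial σ δ k f →
      IsSkewMonomial σ δ (k + 1) (fun a => δ (f a))
  | sigma {k : ℕ} {f : R → R} : IsSkewMonomial σ δ k f →
      IsSkewMonomial σ δ k (fun a => σ (f a))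
  | sigmaInv {k : ℕ} {f : R → R} : IsSkewMonomial σ δ k f →
      IsSkewMonomial σ δ k (fun a => σ.symm (f a))

/-- The data `(σ, δ)` of a skew power series ring over a topological ring `R`: a topological
automorphism `σ` and a continuous left `σ`-derivation `δ` which is `σ`-nilpotent. -/
structure SkewDatum (R : Type*) [Ring R] [TopologicalSpace R] where
  σ : R ≃+* R
  continuous_σ : Continuous σ
  continuous_σ_symm : Continuous σ.symm
  δ : R →+ R
  continuous_δ : Continuous δ
  map_mul : ∀ a b : R, δ (a * b) = δ a * b + σ a * δ b
  nilpotent : ∀ n : ℕ, 1 ≤ n → ∃ m : ℕ, 1 ≤ m ∧ ∀ k : ℕ, m ≤ k → ∀ f : R → R,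
    IsSkewMonomial σ δ k f → ∀ a : R, f a ∈ Ring.jacobson R ^ n

/-- `D.monomialSum k l a` is `M_{k,l}(δ, σ)(a)`, where `M_{k,l}(Y, Z)` is the sum of all
noncommutative monomials with `k` factors `Y` and `l` factors `Z`; the recursion sorts these
monomials by their leftmost factor. -/
def SkewDatum.monomialSum {R : Type*} [Ring R] [TopologicalSpace R] (D : SkewDatum R) :
    ℕ → ℕ → R → R
  | 0, 0, a => a
  | k + 1, 0, a => D.δ (D.monomialSum k 0 a)
  | 0, l + 1, a => D.σ (D.monomialSum 0 l a)
  | k + 1, l + 1, a => D.δ (D.monomialSum k (l + 1) a) + D.σ (D.monomialSum (k + 1) l a)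

/-- The left formal power series `∑ a_i t^i` over `R`, given by their coefficients. -/
def SkewPowerSeries {R : Type*} [Ring R] [TopologicalSpace R] (_D : SkewDatum R) : Type _ := ℕ → R

namespace SkewPowerSeries

section Multiplication

variable {R : Type*} [Ring R]

section Defs

variable [TopologicalSpace R] (D : SkewDatum R)

instance : AddCommGroup (SkewPowerSeries D) := inferInstanceAs (AddCommGroup (ℕ → R))

/-- The product of `∑ x_j t^j` and `∑ y_l t^l`; its `m`-th coefficient is
`∑_{n ≤ m} ∑_{j ≥ n} x_j M_{j-n,n}(δ, σ)(y_{m-n})`, with `j = n + k` below. -/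
noncomputable def mulFun (x y : ℕ → R) : ℕ → R := fun m =>
  ∑ n ∈ Finset.range (m + 1), ∑' k : ℕ, x (n + k) * D.monomialSum k n (y (m - n))

/-- Left multiplication by `t` on coefficient sequences. -/
def shift : (ℕ → R) →+ (ℕ → R) where
  toFun y := fun m => Nat.casesOn m (D.δ (y 0)) (fun i => D.σ (y i) + D.δ (y (i + 1)))
  map_zero' := by ext m; cases m <;> simp
  map_add' x y := by
    ext m
    cases m
    · simp
    · simp; abel

theorem shift_zero (y : ℕ → R) : shift D y 0 = D.δ (y 0) := rfl

theorem shift_succ (y : ℕ → R) (i : ℕ) :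
    shift D y (i + 1) = D.σ (y i) + D.δ (y (i + 1)) := rfl

theorem shift_smul (b : R) (w : ℕ → R) :
    shift D (b • w) = D.σ b • shift D w + D.δ b • w := by
  ext m
  cases m with
  | zero => simp [shift_zero, D.map_mul]; abel
  | succ i => simp [shift_succ, D.map_mul, mul_add]; abel

theorem δ_one : D.δ 1 = 0 := by
  have := D.map_mul 1 1
  simpa using this

theorem monomialSum_zero : ∀ k l : ℕ, D.monomialSum k l 0 = 0
  | 0, 0 => by simp [SkewDatum.monomialSum]
  | k + 1, 0 => by simp [SkewDatum.monomialSum, monomialSum_zero k 0]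
  | 0, l + 1 => by simp [SkewDatum.monomialSum, monomialSum_zero 0 l]
  | k + 1, l + 1 => by
    simp [SkewDatum.monomialSum, monomialSum_zero k (l + 1), monomialSum_zero (k + 1) l]

/-- Coefficient formula for powers of `shift`. -/
def shiftCoeff (j n : ℕ) (a : R) : R := if n ≤ j then D.monomialSum (j - n) n a else 0

theorem shiftCoeff_succ_zero (j : ℕ) (a : R) :
    shiftCoeff D (j + 1) 0 a = D.δ (shiftCoeff D j 0 a) := by
  simp [shiftCoeff, SkewDatum.monomialSum]

theorem shiftCoeff_succ_succ (j n : ℕ) (a : R) :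
    shiftCoeff D (j + 1) (n + 1) a = D.σ (shiftCoeff D j n a) + D.δ (shiftCoeff D j (n + 1) a) := by
  unfold shiftCoeff
  rcases lt_trichotomy n j with h | h | h
  · obtain ⟨d, rfl⟩ := Nat.exists_eq_add_of_lt h
    have e1 : n + d + 1 + 1 - (n + 1) = d + 1 := by omega
    have e2 : n + d + 1 - n = d + 1 := by omega
    have e3 : n + d + 1 - (n + 1) = d := by omega
    rw [if_pos (by omega), if_pos (by omega), if_pos (by omega), e1, e2, e3,
      SkewDatum.monomialSum, add_comm]
  · subst h
    simp [SkewDatum.monomialSum]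
  · rw [if_neg (by omega), if_neg (by omega), if_neg (by omega)]
    simp

theorem shift_iterate_apply (j m : ℕ) (y : ℕ → R) :
    (shift D)^[j] y m = ∑ n ∈ Finset.range (m + 1), shiftCoeff D j n (y (m - n)) := by
  induction j generalizing m with
  | zero =>
    rw [Finset.sum_eq_single_of_mem 0 (by simp)]
    · simp [shiftCoeff, SkewDatum.monomialSum]
    · intro n _ hn
      simp [shiftCoeff, hn]
  | succ j ih =>
    rw [Function.iterate_succ_apply']
    cases m with
    | zero => simp [shift_zero, ih, shiftCoeff_succ_zero]
    | succ i =>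
      rw [shift_succ, ih, ih, Finset.sum_range_succ' _ (i + 1),
        Finset.sum_range_succ' _ (i + 1), map_add, map_sum, map_sum]
      simp only [shiftCoeff_succ_zero, shiftCoeff_succ_succ, Finset.sum_add_distrib,
        Nat.add_sub_add_right, Nat.sub_zero]
      abel

/-- The additive subgroup generated by the values of all monomials with at least `k`
factors `δ`. -/
def valueSubgroup (k : ℕ) : AddSubgroup R :=
  AddSubgroup.closure {b | ∃ i f a, k ≤ i ∧ IsSkewMonomial D.σ D.δ i f ∧ f a = b}

theorem valueSubgroup_anti {k l : ℕ} (h : k ≤ l) : valueSubgroup D l ≤ valueSubgroup D k :=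
  AddSubgroup.closure_mono fun _ ⟨i, f, a, hi, hf, e⟩ => ⟨i, f, a, h.trans hi, hf, e⟩

theorem map_σ_mem {k : ℕ} {b : R} (hb : b ∈ valueSubgroup D k) :
    D.σ b ∈ valueSubgroup D k := by
  induction hb using AddSubgroup.closure_induction with
  | mem b hb =>
    obtain ⟨i, f, a, hi, hf, rfl⟩ := hb
    exact AddSubgroup.subset_closure ⟨i, _, a, hi, hf.sigma, rfl⟩
  | zero => simp
  | add x y _ _ hx hy => rw [map_add]; exact add_mem hx hy
  | neg x _ hx => rw [map_neg]; exact neg_mem hx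

theorem map_δ_mem {k : ℕ} {b : R} (hb : b ∈ valueSubgroup D k) :
    D.δ b ∈ valueSubgroup D (k + 1) := by
  induction hb using AddSubgroup.closure_induction with
  | mem b hb =>
    obtain ⟨i, f, a, hi, hf, rfl⟩ := hb
    exact AddSubgroup.subset_closure ⟨i + 1, _, a, by omega, hf.delta, rfl⟩
  | zero => simp
  | add x y _ _ hx hy => rw [map_add]; exact add_mem hx hy
  | neg x _ hx => rw [map_neg]; exact neg_mem hx

theorem shift_iterate_mem (j m : ℕ) (y : ℕ → R) :
    (shift D)^[j] y m ∈ valueSubgroup D (j - m) := by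
  induction j generalizing m with
  | zero =>
    exact AddSubgroup.subset_closure ⟨0, _, y m, by omega, .one, rfl⟩
  | succ j ih =>
    rw [Function.iterate_succ_apply']
    cases m with
    | zero => exact map_δ_mem D (ih 0)
    | succ i =>
      rw [shift_succ]
      refine add_mem ?_ ?_
      · rw [Nat.add_sub_add_right]
        exact map_σ_mem D (ih i)
      · exact valueSubgroup_anti D (by omega) (map_δ_mem D (ih (i + 1)))

theorem exists_valueSubgroup_le (n : ℕ) :
    ∃ m, ∀ b ∈ valueSubgroup D m, b ∈ Ring.jacobson R ^ n := by
  obtain ⟨m, -, hm⟩ := D.nilpotent (n + 1) (by omega)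
  refine ⟨m, fun b hb => ?_⟩
  induction hb using AddSubgroup.closure_induction with
  | mem b hb =>
    obtain ⟨i, f, a, hi, hf, rfl⟩ := hb
    exact Ideal.pow_le_pow_right (Nat.le_succ n) (hm i hi f hf a)
  | zero => simp
  | add x y _ _ hx hy => exact add_mem hx hy
  | neg x _ hx => exact neg_mem hx

end Defs

/-- A power of the Jacobson radical annihilates a module of finite length. -/
theorem exists_jacobson_pow_smul_eq_zero {M : Type*} [AddCommGroup M] [Module R M]
    (h : IsFiniteLength R M) : ∃ n : ℕ, ∀ a ∈ Ring.jacobson R ^ n, ∀ x : M, a • x = 0 := by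
  induction h with
  | of_subsingleton => exact ⟨0, fun _ _ _ => Subsingleton.elim _ _⟩
  | @of_simple_quotient M _ _ N hs _ ih =>
    obtain ⟨n, hn⟩ := ih
    refine ⟨n + 1, fun a ha x => ?_⟩
    have hJ : ∀ b ∈ Ring.jacobson R, b • x ∈ N := by
      intro b hb
      have := IsSemisimpleModule.jacobson_le_annihilator R (M ⧸ N) hb
      rw [Module.mem_annihilator] at this
      have h2 := this (Submodule.Quotient.mk x)
      rwa [← Submodule.Quotient.mk_smul, Submodule.Quotient.mk_eq_zero] at h2
    rw [Submodule.pow_succ] at ha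
    induction ha using Submodule.mul_induction_on' with
    | mem_mul_mem a ha b hb =>
      rw [mul_smul]
      have := hn a ha ⟨b • x, hJ b hb⟩
      simpa using congrArg Subtype.val this
    | add a _ b _ h1 h2 => rw [add_smul, h1, h2, add_zero]

variable [UniformSpace R] [IsLeftPseudocompactRing R]

theorem continuous_shift (D : SkewDatum R) : Continuous (shift D) := by
  refine continuous_pi fun m => ?_
  cases m with
  | zero => exact D.continuous_δ.comp (continuous_apply 0)
  | succ i =>
    exact (D.continuous_σ.comp (continuous_apply i)).add
      (D.continuous_δ.comp (continuous_apply (i + 1)))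

theorem exists_shift_iterate_mem (D : SkewDatum R) {U : Set R} (hU : U ∈ 𝓝 (0 : R)) :
    ∃ L : Ideal R, IsOpen (L : Set R) ∧ (L : Set R) ⊆ U ∧
      ∀ m : ℕ, ∃ N : ℕ, ∀ j, N ≤ j → ∀ y, (shift D)^[j] y m ∈ L := by
  obtain ⟨L, hL, hLU, hfin⟩ := IsLeftPseudocompactRing.exists_open_left_ideal U hU
  refine ⟨L, hL, hLU, fun m => ?_⟩
  obtain ⟨n, hn⟩ := exists_jacobson_pow_smul_eq_zero hfin
  obtain ⟨k, hk⟩ := exists_valueSubgroup_le D n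
  refine ⟨k + m, fun j hj y => ?_⟩
  have h1 := hk _ (valueSubgroup_anti D (by omega) (shift_iterate_mem D j m y))
  have h2 := hn _ h1 (Submodule.Quotient.mk 1)
  rwa [← Submodule.Quotient.mk_smul, Submodule.Quotient.mk_eq_zero, smul_eq_mul, mul_one] at h2

theorem nonarchimedean : NonarchimedeanAddGroup R where
  is_nonarchimedean U hU := by
    obtain ⟨L, hL, hLU, -⟩ := IsLeftPseudocompactRing.exists_open_left_ideal U hU
    exact ⟨⟨L.toAddSubgroup, hL⟩, hLU⟩

variable (D : SkewDatum R)

theorem summable_aux (x y : ℕ → R) (m : ℕ) :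
    Summable fun j => x j * (shift D)^[j] y m := by
  have := nonarchimedean (R := R)
  apply NonarchimedeanAddGroup.summable_of_tendsto_cofinite_zero
  rw [Nat.cofinite_eq_atTop]
  intro U hU
  obtain ⟨L, -, hLU, hN⟩ := exists_shift_iterate_mem D hU
  obtain ⟨N, hN⟩ := hN m
  refine mem_map.2 ?_
  filter_upwards [eventually_ge_atTop N] with j hj
  exact hLU (L.mul_mem_left _ (hN j hj y))

theorem hasSum_shiftCoeff (x : ℕ → R) (n : ℕ) (a : R) :
    HasSum (fun j => x j * shiftCoeff D j n a)
      (∑' k : ℕ, x (n + k) * D.monomialSum k n a) := by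
  have hs : Summable fun j => x j * shiftCoeff D j n a := by
    have := nonarchimedean (R := R)
    apply NonarchimedeanAddGroup.summable_of_tendsto_cofinite_zero
    rw [Nat.cofinite_eq_atTop]
    intro U hU
    obtain ⟨L, -, hLU, hN⟩ := exists_shift_iterate_mem D hU
    obtain ⟨N, hN⟩ := hN n
    refine mem_map.2 ?_
    filter_upwards [eventually_ge_atTop N] with j hj
    refine hLU (L.mul_mem_left _ ?_)
    have h := hN j hj (Pi.single 0 a)
    rw [shift_iterate_apply, Finset.sum_eq_single_of_mem n (by simp)] at h
    · simpa using h
    · intro i hi hin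
      rw [Finset.mem_range] at hi
      rw [Pi.single_eq_of_ne (by omega)]
      simp [shiftCoeff, monomialSum_zero]
  have he : (∑' k : ℕ, x (n + k) * D.monomialSum k n a) = ∑' j, x j * shiftCoeff D j n a := by
    rw [← (add_right_injective n).tsum_eq (f := fun j => x j * shiftCoeff D j n a)]
    · simp [shiftCoeff]
    · intro j hj
      by_contra hc
      apply hj
      have : ¬ n ≤ j := fun h => hc ⟨j - n, Nat.add_sub_cancel' h⟩
      simp [shiftCoeff, this]
  rw [he]
  exact hs.hasSum

theorem hasSum_mulFun (x y : ℕ → R) :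
    HasSum (fun j => x j • (shift D)^[j] y) (mulFun D x y) := by
  rw [Pi.hasSum]
  intro m
  have : (fun j => (x j • (shift D)^[j] y) m) = fun j => ∑ n ∈ Finset.range (m + 1),
      x j * shiftCoeff D j n (y (m - n)) := by
    ext j
    rw [Pi.smul_apply, shift_iterate_apply, smul_eq_mul, Finset.mul_sum]
  rw [this]
  exact hasSum_sum fun n _ => hasSum_shiftCoeff D x n (y (m - n))

theorem mulFun_add (x y z : ℕ → R) : mulFun D x (y + z) = mulFun D x y + mulFun D x z := by
  refine (hasSum_mulFun D x (y + z)).unique ?_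
  simpa only [iterate_map_add, smul_add] using (hasSum_mulFun D x y).add (hasSum_mulFun D x z)

theorem mulFun_zero (x : ℕ → R) : mulFun D x 0 = 0 := by
  have := mulFun_add D x 0 0
  simpa using this

theorem add_mulFun (x y z : ℕ → R) : mulFun D (x + y) z = mulFun D x z + mulFun D y z := by
  refine (hasSum_mulFun D (x + y) z).unique ?_
  simpa only [Pi.add_apply, add_smul] using (hasSum_mulFun D x z).add (hasSum_mulFun D y z)

theorem single_zero_mulFun (a : R) (y : ℕ → R) : mulFun D (Pi.single 0 a) y = a • y := by
  refine (hasSum_mulFun D _ y).unique ?_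
  convert hasSum_single (f := fun j => (Pi.single 0 a : ℕ → R) j • (shift D)^[j] y) 0 ?_ using 1
  · simp
  · intro j hj
    simp [hj]

theorem mulFun_one (x : ℕ → R) : mulFun D x (Pi.single 0 1) = x := by
  have h : ∀ j, (shift D)^[j] (Pi.single 0 1) = Pi.single j 1 := by
    intro j
    induction j with
    | zero => rfl
    | succ j ih =>
      rw [Function.iterate_succ_apply', ih]
      ext m
      cases m with
      | zero =>
        rw [shift_zero]
        cases j <;> simp [δ_one D]
      | succ i =>
        rw [shift_succ]
        by_cases h1 : i = j
        · subst h1; simp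
        · by_cases h2 : i + 1 = j
          · subst h2; simp [δ_one D]
          · simp [h1, h2]
  refine (hasSum_mulFun D x _).unique ?_
  simp only [h]
  rw [Pi.hasSum]
  intro m
  convert hasSum_single (f := fun j => (x j • (Pi.single j 1 : ℕ → R)) m) m ?_ using 1
  · simp
  · intro j hj
    simp [hj.symm]

/-- Right multiplication as an additive map. -/
noncomputable def mulRight (z : ℕ → R) : (ℕ → R) →+ (ℕ → R) :=
  AddMonoidHom.mk' (fun y => mulFun D y z) fun x y => add_mulFun D x y z

theorem continuous_mulRight (z : ℕ → R) : Continuous (mulRight D z) := by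
  refine continuous_of_continuousAt_zero (mulRight D z) ?_
  rw [ContinuousAt, map_zero, tendsto_pi_nhds]
  intro m U hU
  obtain ⟨L, hL, hLU, hN⟩ := exists_shift_iterate_mem D hU
  obtain ⟨N, hN⟩ := hN m
  have hev : ∀ᶠ y : ℕ → R in 𝓝 0, ∀ j ∈ Finset.range N, y j * (shift D)^[j] z m ∈ L := by
    rw [eventually_all_finset]
    intro j _
    have hc : Continuous fun y : ℕ → R => y j * (shift D)^[j] z m :=
      (continuous_apply j).mul continuous_const
    exact hc.continuousAt.eventually (hL.mem_nhds (by simp))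
  refine mem_map.2 ?_
  filter_upwards [hev] with y hy
  refine hLU ?_
  have hcl : IsClosed (L : Set R) := AddSubgroup.isClosed_of_isOpen L.toAddSubgroup hL
  have hs := Pi.hasSum.1 (hasSum_mulFun D y z) m
  refine hcl.mem_of_tendsto hs (Eventually.of_forall fun s => ?_)
  refine sum_mem fun j _ => ?_
  by_cases hj : j < N
  · exact hy j (by simpa using hj)
  · exact L.mul_mem_left _ (hN j (by omega) z)

theorem shift_mulFun (y z : ℕ → R) : shift D (mulFun D y z) = mulFun D (shift D y) z := by
  have h1 := (hasSum_mulFun D y z).map (shift D) (continuous_shift D)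
  refine h1.unique ?_
  let u : ℕ → R := fun m => Nat.casesOn m 0 (fun i => D.σ (y i))
  let v : ℕ → R := fun m => D.δ (y m)
  have huv : shift D y = u + v := by
    ext m
    cases m
    · simp [u, v, shift_zero]
    · simp [u, v, shift_succ]
  have hu : HasSum (fun l => D.σ (y l) • (shift D)^[l + 1] z) (mulFun D u z) := by
    have := (hasSum_nat_add_iff' 1).2 (hasSum_mulFun D u z)
    simpa [u] using this
  rw [huv, add_mulFun]
  convert hu.add (hasSum_mulFun D v z) using 1
  ext1 l
  simp only [Function.comp_apply, shift_smul, v, Function.iterate_succ_apply']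

theorem shift_iterate_mulFun (j : ℕ) (y z : ℕ → R) :
    (shift D)^[j] (mulFun D y z) = mulFun D ((shift D)^[j] y) z := by
  induction j with
  | zero => rfl
  | succ j ih => rw [Function.iterate_succ_apply', ih, shift_mulFun, Function.iterate_succ_apply']

theorem smul_mulFun (a : R) (y z : ℕ → R) : mulFun D (a • y) z = a • mulFun D y z := by
  refine (hasSum_mulFun D (a • y) z).unique ?_
  simpa only [Pi.smul_apply, smul_assoc] using (hasSum_mulFun D y z).const_smul a

theorem mulFun_assoc (x y z : ℕ → R) :
    mulFun D (mulFun D x y) z = mulFun D x (mulFun D y z) := by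
  have h1 := (hasSum_mulFun D x y).map (mulRight D z) (continuous_mulRight D z)
  refine h1.unique ?_
  convert hasSum_mulFun D x (mulFun D y z) using 1
  ext1 j
  rw [shift_iterate_mulFun, ← smul_mulFun]
  rfl

/-- The skew power series ring `S = R[[t; σ, δ]]`. -/
noncomputable instance : Ring (SkewPowerSeries D) where
  __ := (inferInstance : AddCommGroup (SkewPowerSeries D))
  mul x y := mulFun D x y
  one := (Pi.single 0 1 : ℕ → R)
  mul_assoc := mulFun_assoc D
  one_mul y := (single_zero_mulFun D 1 y).trans (one_smul R (_ : ℕ → R))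
  mul_one := mulFun_one D
  left_distrib := mulFun_add D
  right_distrib := add_mulFun D
  zero_mul z := (mulRight D z).map_zero
  mul_zero := mulFun_zero D

/-- The inclusion of `R` into `S` as the constant power series. -/
noncomputable def C : R →+* SkewPowerSeries D where
  toFun a := (Pi.single 0 a : ℕ → R)
  map_one' := rfl
  map_mul' a b := by
    refine Eq.trans ?_ (single_zero_mulFun D a (Pi.single 0 b)).symm
    funext m
    cases m <;> simp
  map_zero' := Pi.single_zero (M := fun _ : ℕ => R) 0
  map_add' a b := Pi.single_add (f := fun _ : ℕ => R) 0 a b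

/-- The variable `t` of `S`. -/
noncomputable def t : SkewPowerSeries D := (Pi.single 1 1 : ℕ → R)

end Multiplication

end SkewPowerSeries

/-- The twisted module `^σM`: the additive group of `M` with `R` acting through `σ⁻¹`. -/
def TwistedModule {R : Type*} [Ring R] (_σ : R ≃+* R) (M : Type*) : Type _ := M

namespace TwistedModule

variable {R : Type*} [Ring R] (σ : R ≃+* R) (M : Type*) [AddCommGroup M]

instance : AddCommGroup (TwistedModule σ M) := inferInstanceAs (AddCommGroup M)

instance [Module R M] : Module R (TwistedModule σ M) :=
  Module.compHom M (σ.symm : R →+* R)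

/-- The identity map `M → ^σM` of the underlying additive groups. -/
def of : M ≃+ TwistedModule σ M := AddEquiv.refl M

end TwistedModule

section BaseChange

open scoped TensorProduct

variable {R S : Type*} [Ring R] [Ring S] (φ : R →+* S) (M : Type*) [AddCommGroup M] [Module R M]

/-- The `S`-submodule of `S ⊗_ℤ M` generated by the `x φ(a) ⊗ m - x ⊗ a m`. (The additive subgroup
generated by these elements is already stable under `S`.) -/
def balancedRelations : Submodule S (S ⊗[ℤ] M) :=
  Submodule.span S {z | ∃ (x : S) (a : R) (m : M), z = (x * φ a) ⊗ₜ[ℤ] m - x ⊗ₜ[ℤ] (a • m)}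

/-- The tensor product `S ⊗_R M` of the right `R`-module `S` (via `φ : R → S`) with the left
`R`-module `M` over the not necessarily commutative ring `R`, as a left `S`-module. -/
abbrev BaseChange : Type _ := (S ⊗[ℤ] M) ⧸ balancedRelations φ M

variable {M}

/-- The pure tensor `x ⊗ m` in `S ⊗_R M`. -/
def BaseChange.tmul (x : S) (m : M) : BaseChange φ M :=
  Submodule.Quotient.mk (x ⊗ₜ[ℤ] m)

end BaseChange

/-!
Let `S = R[[t; σ, δ]]`. The proof writes power series with their coefficients on the right: since
`σ` is invertible and `δ` is `σ`-nilpotent, left division by `t` with remainder in `R` is possible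
and unique (`exists_eq_t_mul_add_C`, `eq_zero_of_t_mul_add_C`), and iterating it gives a bijection
`S ≅ R^ℕ`, `∑ t^i b_i ↦ (b_i)`, of right `R`-modules (`rightCoeff_ext`, `exists_rightCoeff_eq`). As
`R` is left noetherian, a finitely generated module `M` is finitely presented, so that
`S ⊗_R M ≅ M^ℕ`: every element is uniquely of the form `∑ t^i ⊗ m_i` (`tensorCoeff_ext`,
`exists_tensorCoeff_eq`). In these coordinates `κ` sends `(m_i)` to `(m_{i-1} - t m_i)`, where
`m_{-1} = 0`.

*Injectivity of `κ`.* A sequence in the kernel satisfies `t m_0 = 0` and `t m_{i+1} = m_i`. The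
`R`-submodule `N` generated by the `m_i` satisfies `N ⊆ t^j N` for all `j`, whereas
`t^j N ⊆ Jac(R) N` for large `j` by `σ`-nilpotency; Nakayama's lemma gives `N = 0`
(`eq_zero_of_t_smul_eq`).

*Exactness in the middle.* A preimage `(n_i)` of `z = ∑ t^i ⊗ m_i` should have
`n_i = ∑_{j > i} t^{j-i-1} m_j`. No topology on `M` is needed to make sense of this series: it is
the image under `μ` of the tail `∑_{j > i} t^{j-i-1} ⊗ m_j`, which exists in `S ⊗_R M`
(`exact_kappa_multiplication`).
-/

namespace SkewPowerSeries

/-! ### Left division by `t` and right coefficients -/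

section RightCoefficients

variable {R : Type*} [Ring R]

section Topological

variable [TopologicalSpace R] (D : SkewDatum R)

theorem map_σ_symm_mem {k : ℕ} {b : R}
    (hb : b ∈ valueSubgroup D k) : D.σ.symm b ∈ valueSubgroup D k := by
  induction hb using AddSubgroup.closure_induction with
  | mem b hb =>
    obtain ⟨i, f, a, hi, hf, rfl⟩ := hb
    exact AddSubgroup.subset_closure ⟨i, _, a, hi, hf.sigmaInv, rfl⟩
  | zero => simp
  | add x y _ _ hx hy => rw [map_add]; exact add_mem hx hy
  | neg x _ hx => rw [map_neg]; exact neg_mem hx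

theorem mem_valueSubgroup_zero (a : R) :
    a ∈ valueSubgroup D 0 :=
  AddSubgroup.subset_closure ⟨0, _, a, le_rfl, .one, rfl⟩

/-- The additive map `-σ⁻¹ δ`, which governs left division by `t`. -/
def divStep : R →+ R := -(D.σ.symm : R →+ R).comp D.δ

theorem divStep_apply (a : R) : divStep D a = -D.σ.symm (D.δ a) := rfl

theorem divStep_iterate_mem (k : ℕ) (a : R) : (divStep D)^[k] a ∈ valueSubgroup D k := by
  induction k with
  | zero => exact mem_valueSubgroup_zero D a
  | succ k ih =>
    rw [Function.iterate_succ_apply', divStep_apply]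
    exact neg_mem (map_σ_symm_mem D (map_δ_mem D ih))

/-- The power series with left coefficients `y`. -/
def ofCoeff (y : ℕ → R) : SkewPowerSeries D := y

theorem ofCoeff_add (y z : ℕ → R) : ofCoeff D (y + z) = ofCoeff D y + ofCoeff D z := rfl

theorem ofCoeff_surjective : Function.Surjective (ofCoeff D) := fun x => ⟨x, rfl⟩

theorem ofCoeff_eq_zero {y : ℕ → R} : ofCoeff D y = 0 ↔ y = 0 := Iff.rfl

end Topological

variable [UniformSpace R] (D : SkewDatum R)

theorem t_eq_ofCoeff : t D = ofCoeff D (Pi.single 1 1) := rfl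

variable [IsLeftPseudocompactRing R]

/-- The subgroups `valueSubgroup D k` tend to zero: an open left ideal of finite colength contains
a power of the Jacobson radical, which contains some `valueSubgroup D k` by `σ`-nilpotency. -/
theorem exists_valueSubgroup_subset {U : Set R} (hU : U ∈ 𝓝 (0 : R)) :
    ∃ k, (valueSubgroup D k : Set R) ⊆ U := by
  obtain ⟨L, -, hLU, hfin⟩ := IsLeftPseudocompactRing.exists_open_left_ideal U hU
  obtain ⟨n, hn⟩ := exists_jacobson_pow_smul_eq_zero hfin
  obtain ⟨k, hk⟩ := exists_valueSubgroup_le D n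
  refine ⟨k, fun b hb => hLU ?_⟩
  have h := hn _ (hk b hb) (Submodule.Quotient.mk 1)
  rwa [← Submodule.Quotient.mk_smul, Submodule.Quotient.mk_eq_zero, smul_eq_mul, mul_one] at h

theorem eq_zero_of_forall_mem_valueSubgroup {a : R} (h : ∀ k, a ∈ valueSubgroup D k) : a = 0 := by
  by_contra ha
  obtain ⟨k, hk⟩ := exists_valueSubgroup_subset D (isOpen_compl_singleton.mem_nhds (Ne.symm ha))
  exact hk (h k) rfl

theorem summable_of_mem_valueSubgroup {f : ℕ → R} (c : ℕ)
    (h : ∀ k, f k ∈ valueSubgroup D (k - c)) : Summable f := by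
  have := nonarchimedean (R := R)
  apply NonarchimedeanAddGroup.summable_of_tendsto_cofinite_zero
  rw [Nat.cofinite_eq_atTop]
  intro U hU
  obtain ⟨N, hN⟩ := exists_valueSubgroup_subset D hU
  refine mem_map.2 ?_
  filter_upwards [eventually_ge_atTop (N + c)] with k hk
  exact hN (valueSubgroup_anti D (by omega) (h k))

theorem C_eq_ofCoeff (a : R) : C D a = ofCoeff D (Pi.single 0 a) := rfl

theorem C_mul_ofCoeff (a : R) (y : ℕ → R) : C D a * ofCoeff D y = ofCoeff D (a • y) :=
  single_zero_mulFun D a y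

theorem t_mul_ofCoeff (y : ℕ → R) : t D * ofCoeff D y = ofCoeff D (shift D y) := by
  have h : HasSum (fun j => (Pi.single 1 1 : ℕ → R) j • (shift D)^[j] y) (shift D y) := by
    convert hasSum_single (f := fun j => (Pi.single 1 1 : ℕ → R) j • (shift D)^[j] y) 1 ?_ using 1
    · simp
    · intro j hj
      simp [hj]
  exact (hasSum_mulFun D (Pi.single 1 1) y).unique h

theorem t_mul_C (a : R) : t D * C D a = C D (D.σ a) * t D + C D (D.δ a) := by
  rw [t_eq_ofCoeff, C_mul_ofCoeff, ← t_eq_ofCoeff, C_eq_ofCoeff, C_eq_ofCoeff, t_mul_ofCoeff,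
    ← ofCoeff_add]
  congr 1
  funext m
  rcases m with _ | _ | m
  · simp [shift_zero]
  · simp [shift_succ]
  · simp [shift_succ]

theorem C_mul_t (a : R) :
    C D a * t D = t D * C D (D.σ.symm a) - C D (D.δ (D.σ.symm a)) := by
  rw [t_mul_C]; simp

theorem continuous_divStep : Continuous (divStep D) :=
  (D.continuous_σ_symm.comp D.continuous_δ).neg

/-- Existence of left division by `t` with remainder in `R`. The coefficients of the quotient `y`
must satisfy `y_i = σ⁻¹(x_{i+1}) - σ⁻¹(δ(y_{i+1}))`, which is solved by the convergent series
`y_i = ∑_k (-σ⁻¹δ)^k σ⁻¹(x_{i+1+k})`. -/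
theorem exists_eq_t_mul_add_C (x : SkewPowerSeries D) :
    ∃ (y : SkewPowerSeries D) (b : R), x = t D * y + C D b := by
  obtain ⟨x, rfl⟩ := ofCoeff_surjective D x
  let f (i k : ℕ) : R := (divStep D)^[k] (D.σ.symm (x (i + 1 + k)))
  have hs (i : ℕ) : HasSum (f i) (∑' k, f i k) :=
    (summable_of_mem_valueSubgroup D 0 fun k => divStep_iterate_mem D k _).hasSum
  have hf (i k : ℕ) : f i (k + 1) = divStep D (f (i + 1) k) := by
    simp only [f, Function.iterate_succ_apply', show i + 1 + (k + 1) = i + 1 + 1 + k by omega]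
  let y : ℕ → R := fun i => ∑' k, f i k
  have hy (i : ℕ) : y i = D.σ.symm (x (i + 1)) + divStep D (y (i + 1)) := by
    have h1 := (hs (i + 1)).map (divStep D) (continuous_divStep D)
    have h2 := (hasSum_nat_add_iff' 1).2 (hs i)
    simp only [hf, Finset.sum_range_one] at h2
    exact (sub_eq_iff_eq_add'.1 (h2.unique h1))
  refine ⟨ofCoeff D y, x 0 - D.δ (y 0), ?_⟩
  rw [t_mul_ofCoeff, C_eq_ofCoeff, ← ofCoeff_add]
  congr 1
  funext m
  cases m with
  | zero => simp [shift_zero]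
  | succ i =>
    have h := congrArg D.σ (hy i)
    rw [map_add, divStep_apply, map_neg, RingEquiv.apply_symm_apply,
      RingEquiv.apply_symm_apply] at h
    simp [shift_succ, h]

/-- Uniqueness of left division by `t`. -/
theorem eq_zero_of_t_mul_add_C {y : SkewPowerSeries D} {b : R} (h : t D * y + C D b = 0) :
    y = 0 ∧ b = 0 := by
  obtain ⟨y, rfl⟩ := ofCoeff_surjective D y
  rw [t_mul_ofCoeff, C_eq_ofCoeff, ← ofCoeff_add, ofCoeff_eq_zero] at h
  have hstep (i : ℕ) : y i = divStep D (y (i + 1)) := by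
    have h1 : D.σ (y i) + D.δ (y (i + 1)) = 0 := by simpa [shift_succ] using congrFun h (i + 1)
    rw [divStep_apply, ← map_neg, ← eq_neg_of_add_eq_zero_left h1, RingEquiv.symm_apply_apply]
  have hmem (k : ℕ) : ∀ i, y i = (divStep D)^[k] (y (i + k)) := by
    induction k with
    | zero => intro i; rfl
    | succ k ih => intro i; rw [Function.iterate_succ_apply, ← add_assoc, ← hstep, ← ih]
  have hy : y = 0 := by
    funext i
    refine eq_zero_of_forall_mem_valueSubgroup D fun k => ?_
    rw [hmem k i]
    exact divStep_iterate_mem D k _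
  refine ⟨(ofCoeff_eq_zero D).2 hy, ?_⟩
  simpa [hy] using congrFun h 0

theorem t_mul_add_C_inj {y z : SkewPowerSeries D} {b c : R}
    (h : t D * y + C D b = t D * z + C D c) : y = z ∧ b = c := by
  have : t D * (y - z) + C D (b - c) = 0 := by
    rw [mul_sub, map_sub, ← sub_eq_zero.2 h]; abel
  obtain ⟨h1, h2⟩ := eq_zero_of_t_mul_add_C D this
  exact ⟨sub_eq_zero.1 h1, sub_eq_zero.1 h2⟩

/-- Left division by `t`: the quotient `y` and the remainder `b` in `x = t y + b`. -/
noncomputable def divMod : SkewPowerSeries D →+ SkewPowerSeries D × R :=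
  AddMonoidHom.mk'
    (fun x => ((exists_eq_t_mul_add_C D x).choose, (exists_eq_t_mul_add_C D x).choose_spec.choose))
    fun x y => by
      have hx := (exists_eq_t_mul_add_C D x).choose_spec.choose_spec
      have hy := (exists_eq_t_mul_add_C D y).choose_spec.choose_spec
      have hxy := (exists_eq_t_mul_add_C D (x + y)).choose_spec.choose_spec
      rw [Prod.mk_add_mk, Prod.mk.injEq]
      apply t_mul_add_C_inj D
      rw [← hxy, mul_add, map_add, add_add_add_comm, ← hx, ← hy]

theorem t_mul_divMod_add (x : SkewPowerSeries D) :
    t D * (divMod D x).1 + C D (divMod D x).2 = x :=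
  (exists_eq_t_mul_add_C D x).choose_spec.choose_spec.symm

theorem divMod_t_mul_add_C (y : SkewPowerSeries D) (b : R) :
    divMod D (t D * y + C D b) = (y, b) := by
  obtain ⟨h1, h2⟩ := t_mul_add_C_inj D (t_mul_divMod_add D (t D * y + C D b))
  exact Prod.ext h1 h2

/-- The right coefficient `b_i` of `x = ∑ t^i b_i`, obtained as the remainder after `i` left
divisions by `t`. -/
noncomputable def rightCoeff : ℕ → SkewPowerSeries D →+ R
  | 0 => (AddMonoidHom.snd _ _).comp (divMod D)
  | i + 1 => (rightCoeff i).comp ((AddMonoidHom.fst _ _).comp (divMod D))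

theorem rightCoeff_zero_t_mul_add_C (y : SkewPowerSeries D) (b : R) :
    rightCoeff D 0 (t D * y + C D b) = b :=
  congrArg Prod.snd (divMod_t_mul_add_C D y b)

theorem rightCoeff_succ_t_mul_add_C (i : ℕ) (y : SkewPowerSeries D) (b : R) :
    rightCoeff D (i + 1) (t D * y + C D b) = rightCoeff D i y :=
  congrArg (rightCoeff D i) (congrArg Prod.fst (divMod_t_mul_add_C D y b))

theorem rightCoeff_zero_t_mul (y : SkewPowerSeries D) : rightCoeff D 0 (t D * y) = 0 := by
  simpa using rightCoeff_zero_t_mul_add_C D y 0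

theorem rightCoeff_succ_t_mul (i : ℕ) (y : SkewPowerSeries D) :
    rightCoeff D (i + 1) (t D * y) = rightCoeff D i y := by
  simpa using rightCoeff_succ_t_mul_add_C D i y 0

theorem rightCoeff_zero_C (b : R) : rightCoeff D 0 (C D b) = b := by
  simpa using rightCoeff_zero_t_mul_add_C D 0 b

theorem rightCoeff_succ_C (i : ℕ) (b : R) : rightCoeff D (i + 1) (C D b) = 0 := by
  simpa using rightCoeff_succ_t_mul_add_C D i 0 b

theorem rightCoeff_mul_C (i : ℕ) (x : SkewPowerSeries D) (r : R) :
    rightCoeff D i (x * C D r) = rightCoeff D i x * r := by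
  induction i generalizing x with
  | zero =>
    obtain ⟨y, b, rfl⟩ := exists_eq_t_mul_add_C D x
    rw [add_mul, mul_assoc, ← map_mul, rightCoeff_zero_t_mul_add_C, rightCoeff_zero_t_mul_add_C]
  | succ i ih =>
    obtain ⟨y, b, rfl⟩ := exists_eq_t_mul_add_C D x
    rw [add_mul, mul_assoc, ← map_mul, rightCoeff_succ_t_mul_add_C, rightCoeff_succ_t_mul_add_C,
      ih]

/-- The constant coefficient of `(∑ t^i b_i) t = ∑ (t^{i+1} σ⁻¹(b_i) - t^i δ(σ⁻¹(b_i)))`. -/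
theorem rightCoeff_zero_mul_t (x : SkewPowerSeries D) :
    rightCoeff D 0 (x * t D) = -D.δ (D.σ.symm (rightCoeff D 0 x)) := by
  obtain ⟨y, b, rfl⟩ := exists_eq_t_mul_add_C D x
  have : (t D * y + C D b) * t D =
      t D * (y * t D + C D (D.σ.symm b)) + C D (-D.δ (D.σ.symm b)) := by
    rw [add_mul, C_mul_t, mul_add, map_neg, mul_assoc]; abel
  rw [this, rightCoeff_zero_t_mul_add_C, rightCoeff_zero_t_mul_add_C]

theorem rightCoeff_succ_mul_t (i : ℕ) (x : SkewPowerSeries D) :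
    rightCoeff D (i + 1) (x * t D) =
      D.σ.symm (rightCoeff D i x) - D.δ (D.σ.symm (rightCoeff D (i + 1) x)) := by
  induction i generalizing x with
  | zero =>
    obtain ⟨y, b, rfl⟩ := exists_eq_t_mul_add_C D x
    rw [add_mul, C_mul_t, mul_assoc, add_sub, ← mul_add, sub_eq_add_neg, ← map_neg,
      rightCoeff_succ_t_mul_add_C, map_add, rightCoeff_zero_mul_t, rightCoeff_zero_C,
      rightCoeff_zero_t_mul_add_C, rightCoeff_succ_t_mul_add_C]
    abel
  | succ i ih =>
    obtain ⟨y, b, rfl⟩ := exists_eq_t_mul_add_C D x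
    rw [add_mul, C_mul_t, mul_assoc, add_sub, ← mul_add, sub_eq_add_neg, ← map_neg,
      rightCoeff_succ_t_mul_add_C, map_add, ih, rightCoeff_succ_C, add_zero,
      rightCoeff_succ_t_mul_add_C, rightCoeff_succ_t_mul_add_C]

theorem eq_zero_of_rightCoeff_eq_zero {x : SkewPowerSeries D} (h : ∀ i, rightCoeff D i x = 0) :
    x = 0 := by
  -- A series with vanishing right coefficients is divisible by every power of `t`.
  have hdvd (k : ℕ) : ∀ x : SkewPowerSeries D, (∀ i, rightCoeff D i x = 0) →
      ∃ y : ℕ → R, x = ofCoeff D ((shift D)^[k] y) := by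
    induction k with
    | zero => exact fun x _ => ⟨x, rfl⟩
    | succ k ih =>
      intro x hx
      obtain ⟨y, b, rfl⟩ := exists_eq_t_mul_add_C D x
      have hb : b = 0 := by rw [← rightCoeff_zero_t_mul_add_C D y b, hx 0]
      obtain ⟨z, rfl⟩ := ih y fun i => by rw [← rightCoeff_succ_t_mul_add_C D i y b, hx]
      exact ⟨z, by rw [hb, map_zero, add_zero, t_mul_ofCoeff, Function.iterate_succ_apply']⟩
  obtain ⟨x, rfl⟩ := ofCoeff_surjective D x
  refine (ofCoeff_eq_zero D).2 (funext fun m => ?_)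
  refine eq_zero_of_forall_mem_valueSubgroup D fun k => ?_
  obtain ⟨y, hy⟩ := hdvd (k + m) _ h
  have hxy : x = (shift D)^[k + m] y := hy
  rw [hxy]
  exact valueSubgroup_anti D (by omega) (shift_iterate_mem D (k + m) m y)

theorem rightCoeff_ext {x y : SkewPowerSeries D} (h : ∀ i, rightCoeff D i x = rightCoeff D i y) :
    x = y :=
  sub_eq_zero.1 (eq_zero_of_rightCoeff_eq_zero D fun i => by rw [map_sub, h i, sub_self])

theorem exists_rightCoeff_eq (b : ℕ → R) :
    ∃ x : SkewPowerSeries D, ∀ i, rightCoeff D i x = b i := by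
  let f (b : ℕ → R) (j : ℕ) : ℕ → R := (shift D)^[j] (Pi.single 0 (b j))
  have hf (b : ℕ → R) : Summable (f b) := Pi.summable.2 fun m =>
    summable_of_mem_valueSubgroup D m fun j => shift_iterate_mem D j m _
  let g (b : ℕ → R) : SkewPowerSeries D := ofCoeff D (∑' j, f b j)
  have hfs (b : ℕ → R) (j : ℕ) : f b (j + 1) = shift D (f (fun i => b (i + 1)) j) :=
    Function.iterate_succ_apply' _ _ _
  have hg (b : ℕ → R) : g b = t D * g (fun i => b (i + 1)) + C D (b 0) := by
    rw [t_mul_ofCoeff, C_eq_ofCoeff, ← ofCoeff_add]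
    have h1 := (hf fun i => b (i + 1)).hasSum.map (shift D) (continuous_shift D)
    have h2 := (hasSum_nat_add_iff' 1).2 (hf b).hasSum
    simp only [hfs, Finset.sum_range_one] at h2
    exact congrArg (ofCoeff D) (sub_eq_iff_eq_add.1 (h2.unique h1))
  refine ⟨g b, fun i => ?_⟩
  induction i generalizing b with
  | zero => rw [hg, rightCoeff_zero_t_mul_add_C]
  | succ i ih => rw [hg, rightCoeff_succ_t_mul_add_C, ih]

end RightCoefficients

end SkewPowerSeries

/-! ### Maps out of the tensor product over a noncommutative ring -/

section Lift

open scoped TensorProduct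

namespace BaseChange

variable {R S : Type*} [Ring R] [Ring S] (φ : R →+* S) {M : Type*} [AddCommGroup M] [Module R M]

theorem tmul_add (x : S) (m n : M) : tmul φ x (m + n) = tmul φ x m + tmul φ x n := by
  simp [tmul, TensorProduct.tmul_add]

theorem add_tmul (x y : S) (m : M) : tmul φ (x + y) m = tmul φ x m + tmul φ y m := by
  simp [tmul, TensorProduct.add_tmul]

theorem smul_tmul (x y : S) (m : M) : x • tmul φ y m = tmul φ (x * y) m := rfl

theorem mul_tmul (x : S) (a : R) (m : M) : tmul φ (x * φ a) m = tmul φ x (a • m) :=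
  (Submodule.Quotient.eq _).2 (Submodule.subset_span ⟨x, a, m, rfl⟩)

theorem tmul_zero (x : S) : tmul φ x (0 : M) = 0 := by
  simp [tmul]

/-- `x ↦ x ⊗ m` as an additive map. -/
def tmulLeft (m : M) : S →+ BaseChange φ M :=
  AddMonoidHom.mk' (tmul φ · m) fun x y => add_tmul φ x y m

/-- `m ↦ x ⊗ m` as an additive map. -/
def tmulRight (x : S) : M →+ BaseChange φ M := AddMonoidHom.mk' (tmul φ x) (tmul_add φ x)

theorem sub_tmul (x y : S) (m : M) : tmul φ (x - y) m = tmul φ x m - tmul φ y m :=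
  map_sub (tmulLeft φ m) x y

theorem sum_tmul {ι : Type*} (s : Finset ι) (x : ι → S) (m : M) :
    tmul φ (∑ i ∈ s, x i) m = ∑ i ∈ s, tmul φ (x i) m :=
  map_sum (tmulLeft φ m) x s

theorem tmul_sum {ι : Type*} (s : Finset ι) (x : S) (m : ι → M) :
    tmul φ x (∑ i ∈ s, m i) = ∑ i ∈ s, tmul φ x (m i) :=
  map_sum (tmulRight φ x) m s

@[elab_as_elim]
theorem induction_on {P : BaseChange φ M → Prop} (z : BaseChange φ M) (h0 : P 0)
    (h1 : ∀ x m, P (tmul φ x m)) (h2 : ∀ x y, P x → P y → P (x + y)) : P z := by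
  obtain ⟨w, rfl⟩ := Submodule.Quotient.mk_surjective _ z
  induction w using TensorProduct.induction_on with
  | zero => exact h0
  | tmul x m => exact h1 x m
  | add x y hx hy => exact h2 _ _ hx hy

/-- The additive map out of `S ⊗_ℤ M` given by a biadditive map. -/
def liftInt {N : Type*} [AddCommGroup N] (f : S →+ M →+ N) : S ⊗[ℤ] M →+ N :=
  TensorProduct.liftAddHom f fun k x m => by rw [map_zsmul, map_zsmul]; rfl

/-- The additive map out of `S ⊗_R M` given by a balanced biadditive map. -/
def liftAdd {N : Type*} [AddCommGroup N] (f : S →+ M →+ N)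
    (hf : ∀ x a m, f (x * φ a) m = f x (a • m)) : BaseChange φ M →+ N :=
  QuotientAddGroup.lift (balancedRelations φ M).toAddSubgroup (liftInt f) <| by
    intro z hz
    -- The kernel need not be an `S`-submodule, so all `S`-multiples are treated at once.
    suffices h : ∀ y : S, liftInt f (y • z) = 0 by simpa using h 1
    change z ∈ balancedRelations φ M at hz
    induction hz using Submodule.span_induction with
    | mem z hz =>
      obtain ⟨x, a, m, rfl⟩ := hz
      intro y
      rw [smul_sub, TensorProduct.smul_tmul', TensorProduct.smul_tmul', map_sub, smul_eq_mul,
        smul_eq_mul, ← mul_assoc]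
      exact sub_eq_zero.2 (hf (y * x) a m)
    | zero => simp
    | add z w _ _ hz hw => intro y; rw [smul_add, map_add, hz, hw, add_zero]
    | smul x z _ hz => intro y; rw [smul_smul, hz]

/-- The `S`-linear map `x ⊗ m ↦ x g(m)` induced by an `R`-linear map `g` into an `S`-module. -/
def lift {N : Type*} [AddCommGroup N] [Module S N] (g : M →+ N)
    (hg : ∀ a m, g (a • m) = φ a • g m) : BaseChange φ M →ₗ[S] N where
  toFun := liftAdd φ ((AddMonoidHom.compHom.flip g).comp (smulAddHom S N))
    fun x a m => by simp [hg, mul_smul]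
  map_add' := map_add _
  map_smul' x z := by
    induction z using induction_on with
    | h0 => simp
    | h1 y m => exact mul_smul x y (g m)
    | h2 y z hy hz => rw [smul_add, map_add, hy, hz, map_add, smul_add]

theorem exists_eq_sum_tmul {s : ℕ} {e : Fin s → M} (he : Submodule.span R (Set.range e) = ⊤)
    (z : BaseChange φ M) : ∃ x : Fin s → S, z = ∑ k, tmul φ (x k) (e k) := by
  induction z using induction_on with
  | h0 => exact ⟨0, by simp [tmul]⟩
  | h1 x m =>
    obtain ⟨c, rfl⟩ := (Submodule.mem_span_range_iff_exists_fun R).1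
      (he ▸ Submodule.mem_top : m ∈ Submodule.span R (Set.range e))
    exact ⟨fun k => x * φ (c k), by simp only [tmul_sum, mul_tmul]⟩
  | h2 y z hy hz =>
    obtain ⟨x, rfl⟩ := hy
    obtain ⟨w, rfl⟩ := hz
    exact ⟨x + w, by simp only [Pi.add_apply, add_tmul, Finset.sum_add_distrib]⟩

/-- Generators of `M` over `R` give generators of `S ⊗_R M` over `S`. -/
instance finite [Module.Finite R M] : Module.Finite S (BaseChange φ M) := by
  obtain ⟨s, e, he⟩ := Module.Finite.exists_fin (R := R) (M := M)
  refine Module.Finite.of_surjective (Fintype.linearCombination S fun k => tmul φ 1 (e k)) ?_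
  intro z
  obtain ⟨x, rfl⟩ := exists_eq_sum_tmul φ he z
  exact ⟨x, by simp [Fintype.linearCombination_apply, smul_tmul]⟩

end BaseChange

end Lift

theorem TwistedModule.smul_of {R : Type*} [Ring R] (σ : R ≃+* R) {M : Type*} [AddCommGroup M]
    [Module R M] (a : R) (m : M) : a • of σ M m = of σ M (σ.symm a • m) := rfl

instance TwistedModule.finite {R : Type*} [Ring R] (σ : R ≃+* R) (M : Type*) [AddCommGroup M]
    [Module R M] [Module.Finite R M] : Module.Finite R (TwistedModule σ M) := by
  obtain ⟨s, e, he⟩ := Module.Finite.exists_fin (R := R) (M := M)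
  refine Module.Finite.of_surjective
    (Fintype.linearCombination R fun k => TwistedModule.of σ M (e k)) fun m => ?_
  obtain ⟨c, hc⟩ := (Submodule.mem_span_range_iff_exists_fun R).1
    (he ▸ Submodule.mem_top : (of σ M).symm m ∈ Submodule.span R (Set.range e))
  refine ⟨fun k => σ (c k), ?_⟩
  rw [← (of σ M).apply_symm_apply m, ← hc, map_sum, Fintype.linearCombination_apply]
  refine Finset.sum_congr rfl fun k _ => ?_
  change σ.symm (σ (c k)) • e k = c k • e k
  rw [σ.symm_apply_apply]

namespace SkewPowerSeries

/-! ### The coefficients of an element of `S ⊗_R M` -/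

section Coefficients

variable {R : Type*} [Ring R] [UniformSpace R] [IsLeftPseudocompactRing R] (D : SkewDatum R)
  {M : Type*} [AddCommGroup M] [Module R M]

/-- The coefficients `m_i` of an element `∑ t^i ⊗ m_i` of `S ⊗_R M`. -/
noncomputable def tensorCoeff (i : ℕ) : BaseChange (C D) M →+ M :=
  BaseChange.liftAdd (C D)
    ((smulAddHom R M).comp (rightCoeff D i)) fun x a m => by
      simp [rightCoeff_mul_C, mul_smul]

theorem tensorCoeff_tmul (i : ℕ) (x : SkewPowerSeries D) (m : M) :
    tensorCoeff D i (BaseChange.tmul (C D) x m) = rightCoeff D i x • m := rfl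

theorem tensorCoeff_zero_t_smul (z : BaseChange (C D) M) : tensorCoeff D 0 (t D • z) = 0 := by
  induction z using BaseChange.induction_on with
  | h0 => simp
  | h1 x m => rw [BaseChange.smul_tmul, tensorCoeff_tmul, rightCoeff_zero_t_mul, zero_smul]
  | h2 y z hy hz => rw [smul_add, map_add, hy, hz, add_zero]

theorem tensorCoeff_succ_t_smul (i : ℕ) (z : BaseChange (C D) M) :
    tensorCoeff D (i + 1) (t D • z) = tensorCoeff D i z := by
  induction z using BaseChange.induction_on with
  | h0 => simp
  | h1 x m => rw [BaseChange.smul_tmul, tensorCoeff_tmul, rightCoeff_succ_t_mul, tensorCoeff_tmul]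
  | h2 y z hy hz => rw [smul_add, map_add, hy, hz, map_add]

theorem exists_tensorCoeff_eq [Module.Finite R M] (m : ℕ → M) :
    ∃ z : BaseChange (C D) M, ∀ i, tensorCoeff D i z = m i := by
  obtain ⟨s, e, he⟩ := Module.Finite.exists_fin (R := R) (M := M)
  have hm (i : ℕ) : ∃ c : Fin s → R, ∑ k, c k • e k = m i :=
    (Submodule.mem_span_range_iff_exists_fun R).1 (he ▸ Submodule.mem_top)
  choose c hc using hm
  choose x hx using fun k => exists_rightCoeff_eq D fun i => c i k
  refine ⟨∑ k, BaseChange.tmul (C D) (x k) (e k), fun i => ?_⟩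
  simp only [map_sum, tensorCoeff_tmul, hx, hc]

/-- An element of `S ⊗_R M` is determined by its coefficients. Write it as `∑ x_k ⊗ e_k` for
generators `e_k` of `M`; if its coefficients vanish, then the vectors `(b_{i,k})_k` of right
coefficients of the `x_k` are relations between the `e_k`. As `R` is noetherian, the relations are
generated by finitely many of them, so that `(x_k)_k` is a finite combination of relations with
coefficients in `S`. -/
theorem eq_zero_of_tensorCoeff_eq_zero [IsNoetherianRing R] [Module.Finite R M]
    {z : BaseChange (C D) M} (h : ∀ i, tensorCoeff D i z = 0) : z = 0 := by
  obtain ⟨s, e, he⟩ := Module.Finite.exists_fin (R := R) (M := M)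
  obtain ⟨x, rfl⟩ := BaseChange.exists_eq_sum_tmul (C D) he z
  let K := LinearMap.ker (Fintype.linearCombination R e)
  obtain ⟨p, f, hf⟩ := Submodule.fg_iff_exists_fin_generating_family.1
    (IsNoetherian.noetherian K)
  have hK (i : ℕ) : ∃ c : Fin p → R, ∑ l, c l • f l = fun k => rightCoeff D i (x k) := by
    refine (Submodule.mem_span_range_iff_exists_fun R).1 (hf ▸ ?_)
    rw [LinearMap.mem_ker, Fintype.linearCombination_apply]
    simpa only [map_sum, tensorCoeff_tmul] using h i
  choose c hc using hK
  choose y hy using fun l => exists_rightCoeff_eq D fun i => c i l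
  have hx (k : Fin s) : x k = ∑ l, y l * C D (f l k) := by
    refine rightCoeff_ext D fun i => ?_
    simp only [map_sum, rightCoeff_mul_C, hy]
    simpa using (congrFun (hc i) k).symm
  have hfe (l : Fin p) : ∑ k, f l k • e k = 0 := by
    have : f l ∈ K := hf ▸ Submodule.subset_span ⟨l, rfl⟩
    rwa [LinearMap.mem_ker, Fintype.linearCombination_apply] at this
  simp only [hx, BaseChange.sum_tmul, BaseChange.mul_tmul]
  rw [Finset.sum_comm]
  simp only [← BaseChange.tmul_sum, hfe, BaseChange.tmul_zero, Finset.sum_const_zero]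

theorem tensorCoeff_ext [IsNoetherianRing R] [Module.Finite R M]
    {y z : BaseChange (C D) M} (h : ∀ i, tensorCoeff D i y = tensorCoeff D i z) : y = z :=
  sub_eq_zero.1 (eq_zero_of_tensorCoeff_eq_zero D fun i => by rw [map_sub, h i, sub_self])

/-- The coefficients `m_i` of an element of `S ⊗_R ^σM`, regarded as elements of `M`. -/
noncomputable def twistedCoeff (i : ℕ) : BaseChange (C D) (TwistedModule D.σ M) →+ M :=
  (TwistedModule.of D.σ M).symm.toAddMonoidHom.comp (tensorCoeff D i)

theorem twistedCoeff_tmul (i : ℕ) (x : SkewPowerSeries D) (m : M) :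
    twistedCoeff D i (BaseChange.tmul (C D) x (TwistedModule.of D.σ M m)) =
      D.σ.symm (rightCoeff D i x) • m := rfl

end Coefficients

/-! ### The homomorphisms `κ` and `μ` -/

section Complex

variable {R : Type*} [Ring R] [UniformSpace R] [IsLeftPseudocompactRing R] (D : SkewDatum R)
  {M : Type*} [AddCommGroup M] [Module (SkewPowerSeries D) M] [Module R M]

theorem t_smul_smul (hRM : ∀ (a : R) (m : M), a • m = C D a • m) (a : R) (m : M) :
    t D • (a • m) = D.σ a • (t D • m) + D.δ a • m := by
  simp only [hRM, smul_smul, ← add_smul, t_mul_C]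

theorem smul_t_smul (hRM : ∀ (a : R) (m : M), a • m = C D a • m) (a : R) (m : M) :
    a • (t D • m) = t D • (D.σ.symm a • m) - D.δ (D.σ.symm a) • m := by
  simp [t_smul_smul D hRM]

/-- A sequence `m` in `M` with `t m_0 = 0` and `t m_{i+1} = m_i` vanishes. The `R`-module `N`
generated by the `m_i` is generated by `m_0, …, m_k` for some `k`, and multiplication by `t` acts on
`∑_{n ≤ k} y_n m_{k-n}` through `shift` on the coefficients `y`. By `σ`-nilpotency a power `t^j`
therefore maps `N` into `Jac(R) N`; as `m_i = t^j m_{i+j}`, Nakayama's lemma gives `N = 0`. -/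
theorem eq_zero_of_t_smul_eq [IsNoetherianRing R] [Module.Finite R M]
    (hRM : ∀ (a : R) (m : M), a • m = C D a • m) {m : ℕ → M} (h0 : t D • m 0 = 0)
    (hsucc : ∀ i, t D • m (i + 1) = m i) (i : ℕ) : m i = 0 := by
  let N : ℕ →o Submodule R M :=
    ⟨fun k => Submodule.span R (m '' Set.Iic k), fun k l h =>
      Submodule.span_mono (Set.image_mono (Set.Iic_subset_Iic.2 h))⟩
  obtain ⟨k, hk⟩ := monotone_stabilizes_iff_noetherian.2 (inferInstanceAs (IsNoetherian R M)) N
  have hmem (i : ℕ) : m i ∈ N k := by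
    have h : m i ∈ N (k + i) := Submodule.subset_span ⟨i, by simp, rfl⟩
    rwa [← hk (k + i) (by omega)] at h
  let w (y : ℕ → R) : M := ∑ n ∈ Finset.range (k + 1), y n • m (k - n)
  have hw (y : ℕ → R) : t D • w y = w (shift D y) := by
    simp only [w, Finset.smul_sum, t_smul_smul D hRM, Finset.sum_add_distrib]
    rw [Finset.sum_range_succ' (fun n => shift D y n • m (k - n)),
      Finset.sum_range_succ (fun n => D.σ (y n) • t D • m (k - n)),
      Finset.sum_range_succ' (fun n => D.δ (y n) • m (k - n))]
    simp only [shift_succ, shift_zero, add_smul, Finset.sum_add_distrib, Nat.sub_self, h0,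
      smul_zero, add_zero, Nat.sub_zero]
    rw [← add_assoc]
    congr 2
    refine Finset.sum_congr rfl fun n hn => ?_
    rw [Finset.mem_range] at hn
    rw [← hsucc (k - (n + 1)), show k - (n + 1) + 1 = k - n by omega]
  have hwj (j : ℕ) (y : ℕ → R) : t D ^ j • w y = w ((shift D)^[j] y) := by
    induction j with
    | zero => simp
    | succ j ih => rw [pow_succ', mul_smul, ih, hw, Function.iterate_succ_apply']
  have hspan (x : M) (hx : x ∈ N k) : ∃ y : ℕ → R, w y = x := by
    induction hx using Submodule.span_induction with
    | mem x hx =>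
      obtain ⟨l, hl, rfl⟩ := hx
      rw [Set.mem_Iic] at hl
      refine ⟨Pi.single (k - l) 1, ?_⟩
      simp only [w]
      rw [Finset.sum_eq_single_of_mem (k - l) (by simp)]
      · rw [Pi.single_eq_same, one_smul, Nat.sub_sub_self hl]
      · intro n _ hn
        rw [Pi.single_eq_of_ne hn, zero_smul]
    | zero => exact ⟨0, by simp [w]⟩
    | add x y _ _ hx hy =>
      obtain ⟨a, rfl⟩ := hx
      obtain ⟨b, rfl⟩ := hy
      exact ⟨a + b, by simp [w, add_smul, Finset.sum_add_distrib]⟩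
    | smul r x _ hx =>
      obtain ⟨a, rfl⟩ := hx
      exact ⟨r • a, by simp [w, mul_smul, Finset.smul_sum]⟩
  have hpow (j i : ℕ) : m i = t D ^ j • m (i + j) := by
    induction j with
    | zero => simp
    | succ j ih => rw [ih, pow_succ, mul_smul, ← add_assoc, hsucc]
  obtain ⟨q, hq⟩ := exists_valueSubgroup_le D 1
  have hle : N k ≤ Ring.jacobson R • N k := by
    refine Submodule.span_le.2 ?_
    rintro _ ⟨i, -, rfl⟩
    obtain ⟨y, hy⟩ := hspan _ (hmem (i + (q + k)))
    rw [SetLike.mem_coe, hpow (q + k) i, ← hy, hwj]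
    refine sum_mem fun n hn => Submodule.smul_mem_smul ?_ (hmem _)
    rw [Finset.mem_range] at hn
    refine Ideal.pow_le_self one_ne_zero ?_
    exact hq _ (valueSubgroup_anti D (by omega) (shift_iterate_mem D (q + k) n y))
  have hbot := Submodule.FG.eq_bot_of_le_jacobson_smul (IsNoetherian.noetherian (N k)) hle
  simpa [hbot] using hmem i

/-- The homomorphism `κ`, `x ⊗ m ↦ x t ⊗ m - x ⊗ t m`. -/
noncomputable def kappa (hRM : ∀ (a : R) (m : M), a • m = C D a • m) :
    BaseChange (C D) (TwistedModule D.σ M) →ₗ[SkewPowerSeries D] BaseChange (C D) M :=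
  BaseChange.lift (C D)
    ((BaseChange.tmulRight (C D) (t D) -
        (BaseChange.tmulRight (C D) 1).comp (DistribSMul.toAddMonoidHom M (t D))).comp
      (TwistedModule.of D.σ M).symm.toAddMonoidHom) fun a m => by
    obtain ⟨m, rfl⟩ := (TwistedModule.of D.σ M).surjective m
    obtain ⟨a, rfl⟩ := D.σ.surjective a
    rw [TwistedModule.smul_of, D.σ.symm_apply_apply]
    change BaseChange.tmul (C D) (t D) (a • m) - BaseChange.tmul (C D) 1 (t D • (a • m)) =
      C D (D.σ a) • (BaseChange.tmul (C D) (t D) m - BaseChange.tmul (C D) 1 (t D • m))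
    rw [t_smul_smul D hRM, BaseChange.tmul_add, smul_sub, BaseChange.smul_tmul,
      BaseChange.smul_tmul, eq_sub_of_add_eq (t_mul_C D a).symm, mul_one,
      ← one_mul (C D (D.σ a)), BaseChange.mul_tmul, BaseChange.sub_tmul, BaseChange.mul_tmul,
      ← one_mul (C D (D.δ a)), BaseChange.mul_tmul]
    abel

theorem kappa_tmul (hRM : ∀ (a : R) (m : M), a • m = C D a • m) (x : SkewPowerSeries D) (m : M) :
    kappa D hRM (BaseChange.tmul (C D) x (TwistedModule.of D.σ M m)) =
      BaseChange.tmul (C D) (x * t D) m - BaseChange.tmul (C D) x (t D • m) := by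
  change x • (BaseChange.tmul (C D) (t D) m - BaseChange.tmul (C D) 1 (t D • m)) = _
  rw [smul_sub, BaseChange.smul_tmul, BaseChange.smul_tmul, mul_one]

/-- The homomorphism `μ`, `x ⊗ m ↦ x m`. -/
noncomputable def multiplication (hRM : ∀ (a : R) (m : M), a • m = C D a • m) :
    BaseChange (C D) M →ₗ[SkewPowerSeries D] M :=
  BaseChange.lift (C D) (AddMonoidHom.id M) hRM

theorem multiplication_tmul (hRM : ∀ (a : R) (m : M), a • m = C D a • m)
    (x : SkewPowerSeries D) (m : M) :
    multiplication D hRM (BaseChange.tmul (C D) x m) = x • m := rfl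

theorem tensorCoeff_zero_kappa (hRM : ∀ (a : R) (m : M), a • m = C D a • m)
    (y : BaseChange (C D) (TwistedModule D.σ M)) :
    tensorCoeff D 0 (kappa D hRM y) = -(t D • twistedCoeff D 0 y) := by
  induction y using BaseChange.induction_on with
  | h0 => simp
  | h1 x m =>
    obtain ⟨m, rfl⟩ := (TwistedModule.of D.σ M).surjective m
    rw [kappa_tmul, map_sub, tensorCoeff_tmul, tensorCoeff_tmul, rightCoeff_zero_mul_t,
      smul_t_smul D hRM, twistedCoeff_tmul, neg_smul]
    abel
  | h2 y z hy hz => rw [map_add, map_add, hy, hz, map_add, smul_add, neg_add]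

theorem tensorCoeff_succ_kappa (hRM : ∀ (a : R) (m : M), a • m = C D a • m) (i : ℕ)
    (y : BaseChange (C D) (TwistedModule D.σ M)) :
    tensorCoeff D (i + 1) (kappa D hRM y) =
      twistedCoeff D i y - t D • twistedCoeff D (i + 1) y := by
  induction y using BaseChange.induction_on with
  | h0 => simp
  | h1 x m =>
    obtain ⟨m, rfl⟩ := (TwistedModule.of D.σ M).surjective m
    rw [kappa_tmul, map_sub, tensorCoeff_tmul, tensorCoeff_tmul, rightCoeff_succ_mul_t,
      smul_t_smul D hRM, twistedCoeff_tmul, twistedCoeff_tmul, sub_smul]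
    abel
  | h2 y z hy hz => rw [map_add, map_add, hy, hz, map_add, map_add, smul_add]; abel

theorem kappa_injective [IsNoetherianRing R] [Module.Finite R M]
    (hRM : ∀ (a : R) (m : M), a • m = C D a • m) : Function.Injective (kappa D hRM) := by
  refine (injective_iff_map_eq_zero _).2 fun y hy => ?_
  refine eq_zero_of_tensorCoeff_eq_zero D fun i => (TwistedModule.of D.σ M).symm.injective ?_
  refine eq_zero_of_t_smul_eq D hRM (m := fun i => twistedCoeff D i y) ?_ (fun i => ?_) i
  · rw [← neg_eq_zero, ← tensorCoeff_zero_kappa D hRM, hy, map_zero]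
  · rw [eq_comm, ← sub_eq_zero, ← tensorCoeff_succ_kappa D hRM, hy, map_zero]

/-- For `z = ∑ t^i ⊗ m_i` in the kernel of `μ`, let `z_i` be the element `∑ t^j ⊗ m_{i+1+j}`, so
that `z = 1 ⊗ m_0 + t z_0` and `z_i = 1 ⊗ m_{i+1} + t z_{i+1}`. Applying `μ` shows that the element with
coefficients `μ(z_i)` is a preimage of `z` under `κ`. -/
theorem exact_kappa_multiplication [IsNoetherianRing R] [Module.Finite R M]
    (hRM : ∀ (a : R) (m : M), a • m = C D a • m) :
    Function.Exact (kappa D hRM) (multiplication D hRM) := by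
  intro z
  constructor
  · intro hz
    choose u hu using fun i => exists_tensorCoeff_eq D fun j => tensorCoeff D (i + j) z
    have hu0 : u 0 = z := tensorCoeff_ext D fun j => by rw [hu, zero_add]
    have hrec (i : ℕ) : u i = BaseChange.tmul (C D) 1 (tensorCoeff D i z) + t D • u (i + 1) := by
      refine tensorCoeff_ext D fun j => ?_
      rw [map_add, tensorCoeff_tmul, hu, ← map_one (C D)]
      cases j with
      | zero => rw [tensorCoeff_zero_t_smul, rightCoeff_zero_C, one_smul, add_zero, add_zero]
      | succ j =>
        rw [tensorCoeff_succ_t_smul, rightCoeff_succ_C, zero_smul, zero_add, hu, add_right_comm,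
          add_assoc]
    have hμ (i : ℕ) : multiplication D hRM (u i) =
        tensorCoeff D i z + t D • multiplication D hRM (u (i + 1)) := by
      conv_lhs => rw [hrec i, map_add, multiplication_tmul, one_smul, map_smul]
    obtain ⟨y, hy⟩ := exists_tensorCoeff_eq D fun i =>
      TwistedModule.of D.σ M (multiplication D hRM (u (i + 1)))
    have hy' (i : ℕ) : twistedCoeff D i y = multiplication D hRM (u (i + 1)) :=
      congrArg (TwistedModule.of D.σ M).symm (hy i)
    refine ⟨y, tensorCoeff_ext D fun i => ?_⟩
    cases i with
    | zero =>
      rw [tensorCoeff_zero_kappa, hy', neg_eq_iff_add_eq_zero, add_comm, ← hμ, hu0, hz]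
    | succ i => rw [tensorCoeff_succ_kappa, hy', hy', hμ (i + 1), add_sub_cancel_right]
  · rintro ⟨y, rfl⟩
    induction y using BaseChange.induction_on with
    | h0 => simp
    | h1 x m =>
      obtain ⟨m, rfl⟩ := (TwistedModule.of D.σ M).surjective m
      rw [kappa_tmul, map_sub, multiplication_tmul, multiplication_tmul, mul_smul, sub_self]
    | h2 y z hy hz => rw [map_add, map_add, hy, hz, add_zero]

theorem multiplication_surjective (hRM : ∀ (a : R) (m : M), a • m = C D a • m) :
    Function.Surjective (multiplication D hRM) := fun m =>
  ⟨BaseChange.tmul (C D) 1 m, one_smul _ m⟩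

theorem finite_of_finite_coeff [Module.Finite R M]
    (hRM : ∀ (a : R) (m : M), a • m = C D a • m) : Module.Finite (SkewPowerSeries D) M :=
  Module.Finite.of_surjective _ (multiplication_surjective D hRM)

end Complex

end SkewPowerSeries

/-- Here `S = R[[t; σ, δ]]`, both `R` and `S` are left and right noetherian, and `M` is a left
`S`-module which is finitely generated over `R`, where `R` acts through `R → S`. -/
theorem proposition2p2 {R : Type*} [Ring R] [UniformSpace R] [IsLeftPseudocompactRing R]
    [IsNoetherianRing R] [IsNoetherianRing Rᵐᵒᵖ] (D : SkewDatum R)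
    [IsNoetherianRing (SkewPowerSeries D)] [IsNoetherianRing (SkewPowerSeries D)ᵐᵒᵖ]
    {M : Type*} [AddCommGroup M] [Module (SkewPowerSeries D) M] [Module R M]
    (hRM : ∀ (a : R) (m : M), a • m = SkewPowerSeries.C D a • m) [Module.Finite R M] :
    Module.Finite (SkewPowerSeries D)
        (BaseChange (SkewPowerSeries.C D) (TwistedModule D.σ M)) ∧
    Module.Finite (SkewPowerSeries D) (BaseChange (SkewPowerSeries.C D) M) ∧
    Module.Finite (SkewPowerSeries D) M ∧
    ∃ (κ : BaseChange (SkewPowerSeries.C D) (TwistedModule D.σ M) →ₗ[SkewPowerSeries D]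
          BaseChange (SkewPowerSeries.C D) M)
      (μ : BaseChange (SkewPowerSeries.C D) M →ₗ[SkewPowerSeries D] M),
      (∀ (x : SkewPowerSeries D) (m : M),
        κ (BaseChange.tmul (SkewPowerSeries.C D) x (TwistedModule.of D.σ M m)) =
          BaseChange.tmul (SkewPowerSeries.C D) (x * SkewPowerSeries.t D) m -
            BaseChange.tmul (SkewPowerSeries.C D) x (SkewPowerSeries.t D • m)) ∧
      (∀ (x : SkewPowerSeries D) (m : M),
        μ (BaseChange.tmul (SkewPowerSeries.C D) x m) = x • m) ∧
      Function.Injective κ ∧ Function.Exact κ μ ∧ Function.Surjective μ := by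
  exact ⟨inferInstance, inferInstance, SkewPowerSeries.finite_of_finite_coeff D hRM,
    SkewPowerSeries.kappa D hRM, SkewPowerSeries.multiplication D hRM,
    SkewPowerSeries.kappa_tmul D hRM, SkewPowerSeries.multiplication_tmul D hRM,
    SkewPowerSeries.kappa_injective D hRM, SkewPowerSeries.exact_kappa_multiplication D hRM,
    SkewPowerSeries.multiplication_surjective D hRM⟩
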